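/- Contextual linear bandit. There are $M$ contexts; context $m\in[M]$ has a finite action set $\mathcal A^m\subset\mathbb R^d$ with $|\mathcal A^m|=K$ that spans $\mathbb R^d$, and $\|x\|_2\le 1$ for every $x\in\mathcal A^m$. In round $t=1,2,\dots$ a context $c_t$ is drawn independently from a distribution $p$ on $[M]$ with $p(m)>0$ for all $m$; the learner, who sees $c_t$ and all earlier contexts, actions and rewards, plays a (possibly randomised) action $X_t\in\mathcal A^{c_t}$ and receives $Y_t=\langle X_t,\theta\rangle+\eta_t$, where the $\eta_t$ are independent standard Gaussians and $\theta\in\mathbb R^d$ is unknown. The optimal arm of context $m$ is $x_m^*\in\operatorname{argmax}_{x\in\mathcal A^m}\langle x,\theta\rangle$, and the expected regret of a policy $\pi$ is $$R_\theta^\pi(n)=\mathbb E\Big[\sum_{t=1}^n\langle x_{c_t}^*,\theta\rangle-\sum_{t=1}^nY_t\Big].$$ Let $G_t=\sum_{s=1}^tX_sX_s^\top$, $\hat\theta_t=G_t^{-1}\sum_{s=1}^tX_sY_s$ and $\|x\|_A=\sqrt{x^\top Ax}$. Given $\beta_t\ge 0$, LinUCB plays in the first $d$ rounds any action of $\mathcal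 A^{c_t}$ that is not in the span of $X_1,\dots,X_{t-1}$, and in every later round $$X_t\in\operatorname{argmax}_{x\in\mathcal A^{c_t}}\ \langle x,\hat\theta_{t-1}\rangle+\|x\|_{G_{t-1}^{-1}}\,\beta_t^{1/2},$$ with ties broken arbitrarily. Theorem. There are an absolute constant $C>0$ and, for each $d$, confidence radii $\beta_t\ge0$ that depend only on $d$ and $t$, with $\beta_t\le C\,d\log t$ for all $t\ge2$, such that the following holds for all $M$, $K$, $\mathcal A^1,\dots,\mathcal A^M$, $p$ and $\theta$ as above. If the optimal arms $\{x_1^*,\dots,x_M^*\}$ span $\mathbb R^d$ (when some optimal arm is not unique: if they do so for every choice of the optimal arms), then every LinUCB policy $\pi$ with the radii $(\beta_t)$ satisfies $$\limsup_{n\to\infty}R_\theta^\pi(n)<\infty .$$ -/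

import Mathlib

open MeasureTheory ProbabilityTheory Filter

noncomputable section

namespace LinBandit

/-- The vectors of `ℝ^d`, with the Euclidean inner product and norm. -/
abbrev Vec (d : ℕ) : Type := EuclideanSpace ℝ (Fin d)

/-- What the learner observes in one round: the context, the action played, the reward. -/
abbrev Round (d M : ℕ) : Type := Fin M × Vec d × ℝ

/-- The observations of the first `t` rounds, in order. -/
abbrev History (d M t : ℕ) : Type := Fin t → Round d M

/-- A stochastic contextual linear bandit with `M` contexts and `K` actions in each of them.
The reward of an action `x` is `⟨x, θ⟩` plus an independent standard Gaussian. -/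
structure Bandit (d M K : ℕ) where
  /-- the action set of each context -/
  actions : Fin M → Finset (Vec d)
  card_actions : ∀ m, (actions m).card = K
  span_actions : ∀ m, Submodule.span ℝ (actions m : Set (Vec d)) = ⊤
  norm_le_one : ∀ m, ∀ x ∈ actions m, ‖x‖ ≤ 1
  /-- the distribution of the contexts -/
  p : PMF (Fin M)
  p_pos : ∀ m, 0 < p m
  /-- the parameter, which the learner does not know -/
  θ : Vec d

/-- A (possibly randomised) policy: the action of each round is a measurable function of the
observations of the earlier rounds, of the current context and of a fresh seed, which is uniform
on `[0, 1]`. -/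
structure Policy (d M : ℕ) where
  select : (t : ℕ) → History d M t → Fin M → unitInterval → Vec d
  measurable_select : ∀ t,
    Measurable fun q : History d M t × Fin M × unitInterval => select t q.1 q.2.1 q.2.2

section LeastSquares

variable {d M t : ℕ}

/-- The Gram matrix `G_t = ∑_{s ≤ t} X_s X_sᵀ` of a history. -/
def gram (h : History d M t) : Matrix (Fin d) (Fin d) ℝ :=
  ∑ s, Matrix.vecMulVec (h s).2.1.ofLp (h s).2.1.ofLp

/-- The least squares estimator `G_t⁻¹ ∑_{s ≤ t} X_s Y_s` of a history. -/
def thetaHat (h : History d M t) : Vec d :=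
  WithLp.toLp 2 (Matrix.mulVec (gram h)⁻¹ (∑ s, (h s).2.2 • (h s).2.1.ofLp))

/-- The weighted norm `‖x‖_A = √(xᵀ A x)`. -/
def wnorm (A : Matrix (Fin d) (Fin d) ℝ) (x : Vec d) : ℝ :=
  Real.sqrt (x.ofLp ⬝ᵥ Matrix.mulVec A x.ofLp)

/-- The optimistic index `⟨x, θ̂⟩ + ‖x‖_{G⁻¹} b^{1/2}` of `x` after a history. -/
def ucbIndex (h : History d M t) (b : ℝ) (x : Vec d) : ℝ :=
  inner ℝ x (thetaHat h) + wnorm (gram h)⁻¹ x * Real.sqrt b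

end LeastSquares

/-- `π` is LinUCB with the confidence radii `β` for the action sets `A`. Here `h` consists of `t`
rounds, so the action is chosen for round `t + 1`. In the first `d` rounds an action outside the
span of the earlier ones is played; afterwards an action with the largest index.
Choices that this leaves open (initial actions, ties) are arbitrary. -/
def Policy.IsLinUCB {d M : ℕ} (π : Policy d M) (A : Fin M → Finset (Vec d)) (β : ℕ → ℝ) : Prop :=
  ∀ (t : ℕ) (h : History d M t) (m : Fin M) (u : unitInterval),
    π.select t h m u ∈ A m ∧
    (t < d → π.select t h m u ∉ Submodule.span ℝ (Set.range fun s => (h s).2.1)) ∧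
    (d ≤ t → IsUnit (gram h) →
      ∀ x ∈ A m, ucbIndex h (β (t + 1)) x ≤ ucbIndex h (β (t + 1)) (π.select t h m u))

/-- The primitive randomness: for each round the context, the noise and the learner's seed. -/
abbrev Sample (M : ℕ) : Type := ℕ → Fin M × ℝ × unitInterval

namespace Bandit

variable {d M K : ℕ} (B : Bandit d M K) (π : Policy d M)

/-- All rounds are independent; in each of them the context (with law `p`), the noise (standard
Gaussian) and the seed (uniform) are independent. -/
def law : Measure (Sample M) :=
  Measure.infinitePi fun _ : ℕ =>
    B.p.toMeasure.prod ((gaussianReal 0 1).prod (volume : Measure unitInterval))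

/-- The record of the first `t` rounds of the interaction of `π` with `B`. -/
def history : (t : ℕ) → Sample M → History d M t
  | 0, _ => Fin.elim0
  | t + 1, ω =>
    let x : Vec d := π.select t (history t ω) (ω t).1 (ω t).2.2
    Fin.snoc (α := fun _ => Round d M) (history t ω)
      ((ω t).1, x, inner ℝ x B.θ + (ω t).2.1)

/-- The action played in round `t + 1`. -/
def action (t : ℕ) (ω : Sample M) : Vec d :=
  π.select t (B.history π t ω) (ω t).1 (ω t).2.2

/-- The reward of round `t + 1`. -/
def reward (t : ℕ) (ω : Sample M) : ℝ :=
  inner ℝ (B.action π t ω) B.θ + (ω t).2.1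

/-- `x` is an optimal action in context `m`. -/
def IsOptimal (m : Fin M) (x : Vec d) : Prop :=
  x ∈ B.actions m ∧ ∀ y ∈ B.actions m, inner ℝ y B.θ ≤ inner ℝ x B.θ

/-- The mean reward `⟨x_m^*, θ⟩ = max_{x ∈ A^m} ⟨x, θ⟩` of an optimal action in context `m`. -/
def optValue (m : Fin M) : ℝ := ⨆ x : B.actions m, inner ℝ (x : Vec d) B.θ

/-- The random regret `∑_{t ≤ n} ⟨x_{c_t}^*, θ⟩ - ∑_{t ≤ n} Y_t`. -/
def randomRegret (n : ℕ) (ω : Sample M) : ℝ :=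
  ∑ t ∈ Finset.range n, B.optValue (ω t).1 - ∑ t ∈ Finset.range n, B.reward π t ω

/-- The expected cumulative regret `R_θ^π(n)`. -/
def regret (n : ℕ) : ℝ := ∫ ω, B.randomRegret π n ω ∂B.law

end Bandit

end LinBandit

end

/-! Exploration comes for free once an optimal arm is played linearly often in every context. These
arms span the space, so `G_t` dominates a multiple of `t` times the identity and every confidence
width is of order `√(log t / t)`. Finitely many actions leave a smallest positive gap `Δ`; once the
widths are below it, optimism excludes every suboptimal action. Regret then comes only from failure
events whose probabilities are summable.

Linear play of optimal arms is a counting argument. An action played `N` times has width at most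
`N^(-1/2)`, so under valid confidence bounds a suboptimal action can be chosen only while `N` is at
most of order `log t / Δ²` (`pairCount_suboptimal_le`). The bounds are needed only at times in `[εt,
t]`, because earlier rounds add at most about `εt` plays. Each context occurs at least `q t` times
up to exponentially small probability (`measure_contextCount_le`), so by pigeonhole over its `K`
actions one is played `2εt` times, too often to be suboptimal. This is `exists_eventually_optimal`.

For the confidence bounds, let `S = ∑ X_s η_s` and `Q(y) = yᵀ G_t y`. For fixed `y`, `exp(⟨S, y⟩ -
Q(y)/2)` has mean at most one. A union bound over a polynomially fine grid, which contains a point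
close to `θ̂ - θ`, gives failure probability at most `t^(-3)` with radius `15 d log t`
(`measure_radius_lt_energy`). Summed over `[εt, t]` this is `O(t^(-2))`. -/

noncomputable section

namespace LinBandit

/-! ### Gram matrix, confidence widths and optimism -/

section Energy

variable {d M t : ℕ}

/-- The quadratic form `yᵀ G_t y` of the Gram matrix of a history. -/
def energy (h : History d M t) (y : Vec d) : ℝ := ∑ s, inner ℝ (h s).2.1 y ^ 2

lemma energy_nonneg (h : History d M t) (y : Vec d) : 0 ≤ energy h y :=
  Finset.sum_nonneg fun _ _ => sq_nonneg _

lemma dotProduct_gram_mulVec (h : History d M t) (y z : Vec d) :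
    y.ofLp ⬝ᵥ Matrix.mulVec (gram h) z.ofLp
      = ∑ s, inner ℝ (h s).2.1 y * inner ℝ (h s).2.1 z := by
  simp only [gram, Matrix.sum_mulVec, dotProduct_sum, Matrix.vecMulVec_mulVec]
  refine Finset.sum_congr rfl fun s _ => ?_
  simp [EuclideanSpace.inner_eq_star_dotProduct, dotProduct_smul, dotProduct_comm, mul_comm]

lemma isUnit_gram (h : History d M t) (hpos : ∀ y, y ≠ 0 → 0 < energy h y) :
    IsUnit (gram h) := by
  rw [← Matrix.mulVec_injective_iff_isUnit]
  intro a b hab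
  by_contra hne
  have hy : WithLp.toLp 2 (a - b) ≠ (0 : Vec d) := by
    intro h0
    apply hne
    have := congrArg WithLp.ofLp h0
    simpa [sub_eq_zero] using this
  have h1 := hpos _ hy
  have h2 := dotProduct_gram_mulVec h (WithLp.toLp 2 (a - b)) (WithLp.toLp 2 (a - b))
  simp only [Matrix.mulVec_sub, hab, sub_self, dotProduct_zero] at h2
  simp only [energy, sq] at h1
  linarith

/-- The vector `G_t⁻¹ x`. -/
def gramInv (h : History d M t) (x : Vec d) : Vec d :=
  WithLp.toLp 2 (Matrix.mulVec (gram h)⁻¹ x.ofLp)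

/-- Substituting `x = G (G⁻¹ x)` turns the Euclidean product into the Gram form, so that
Cauchy–Schwarz for finite sums yields the bound by widths. -/
lemma inner_eq_sum_gramInv (h : History d M t) (hG : IsUnit (gram h)) (x y : Vec d) :
    inner ℝ x y = ∑ s, inner ℝ (h s).2.1 (gramInv h x) * inner ℝ (h s).2.1 y := by
  have hdet : IsUnit (gram h).det := (Matrix.isUnit_iff_isUnit_det _).1 hG
  have h1 := dotProduct_gram_mulVec h y (gramInv h x)
  rw [gramInv, Matrix.mulVec_mulVec, Matrix.mul_nonsing_inv _ hdet, Matrix.one_mulVec] at h1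
  rw [EuclideanSpace.inner_eq_star_dotProduct]
  simp only [star_trivial]
  rw [h1]
  exact Finset.sum_congr rfl fun s _ => mul_comm _ _

lemma energy_gramInv (h : History d M t) (hG : IsUnit (gram h)) (x : Vec d) :
    energy h (gramInv h x) = inner ℝ x (gramInv h x) := by
  rw [inner_eq_sum_gramInv h hG]
  exact Finset.sum_congr rfl fun s _ => sq _

lemma wnorm_eq_sqrt_energy (h : History d M t) (hG : IsUnit (gram h)) (x : Vec d) :
    wnorm (gram h)⁻¹ x = Real.sqrt (energy h (gramInv h x)) := by
  rw [energy_gramInv h hG, wnorm, EuclideanSpace.inner_eq_star_dotProduct, gramInv]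
  simp [dotProduct_comm]

lemma abs_inner_le_wnorm_mul (h : History d M t) (hG : IsUnit (gram h)) (x y : Vec d) :
    |inner ℝ x y| ≤ wnorm (gram h)⁻¹ x * Real.sqrt (energy h y) := by
  rw [wnorm_eq_sqrt_energy h hG, ← Real.sqrt_mul (energy_nonneg _ _)]
  apply Real.abs_le_sqrt
  rw [inner_eq_sum_gramInv h hG x y]
  exact Finset.sum_mul_sq_le_sq_mul_sq _ _ _

lemma wnorm_nonneg (A : Matrix (Fin d) (Fin d) ℝ) (x : Vec d) : 0 ≤ wnorm A x :=
  Real.sqrt_nonneg _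

lemma wnorm_sq (h : History d M t) (hG : IsUnit (gram h)) (x : Vec d) :
    wnorm (gram h)⁻¹ x ^ 2 = energy h (gramInv h x) := by
  rw [wnorm_eq_sqrt_energy h hG, Real.sq_sqrt (energy_nonneg _ _)]

/-- With `w = G⁻¹ x`, `l ‖w‖² ≤ Q(w) = ⟨x, w⟩ ≤ ‖w‖`. Hence `l ‖w‖ ≤ 1`, and so `l Q(w) ≤ 1`, where
`Q(w)` is the squared width. -/
lemma mul_wnorm_sq_le (h : History d M t) (hG : IsUnit (gram h)) {l : ℝ} (hl : 0 < l)
    (hle : ∀ y, l * ‖y‖ ^ 2 ≤ energy h y) {x : Vec d} (hx : ‖x‖ ≤ 1) :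
    l * wnorm (gram h)⁻¹ x ^ 2 ≤ 1 := by
  rw [wnorm_sq h hG]
  set w := gramInv h x
  have h1 : energy h w ≤ ‖w‖ := by
    rw [energy_gramInv h hG]
    calc inner ℝ x w ≤ ‖x‖ * ‖w‖ := real_inner_le_norm _ _
      _ ≤ 1 * ‖w‖ := by gcongr
      _ = ‖w‖ := one_mul _
  have h2 := hle w
  have h3 := energy_nonneg h w
  have h4 : l * ‖w‖ ≤ 1 := by
    rcases (norm_nonneg w).eq_or_lt with h0 | h0
    · simp [← h0]
    · by_contra! hc
      have : ‖w‖ < l * ‖w‖ * ‖w‖ := by nlinarith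
      nlinarith
  nlinarith

/-- The `N` plays of `x` alone contribute `N ⟨x, w⟩² = N Q(w)²` to `Q(w)`, where `w = G⁻¹ x`; divide
by `Q(w)`. An action's own plays thus suffice to shrink its width. -/
lemma card_mul_wnorm_sq_le (h : History d M t) (hG : IsUnit (gram h)) (x : Vec d) :
    (Finset.card {s | (h s).2.1 = x} : ℝ) * wnorm (gram h)⁻¹ x ^ 2 ≤ 1 := by
  rw [wnorm_sq h hG]
  set w := gramInv h x
  have h1 : (Finset.card {s | (h s).2.1 = x} : ℝ) * inner ℝ x w ^ 2 ≤ energy h w := by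
    calc (Finset.card {s | (h s).2.1 = x} : ℝ) * inner ℝ x w ^ 2
        = ∑ s with (h s).2.1 = x, inner ℝ (h s).2.1 w ^ 2 := by
          rw [Finset.sum_congr rfl (g := fun _ => inner ℝ x w ^ 2)]
          · simp
          · intro s hs
            simp only [Finset.mem_filter] at hs
            rw [hs.2]
      _ ≤ energy h w := Finset.sum_le_sum_of_subset_of_nonneg (Finset.filter_subset _ _)
          fun _ _ _ => sq_nonneg _
  have h2 := energy_gramInv h hG x
  have h3 := energy_nonneg h w
  change energy h w = inner ℝ x w at h2
  rw [← h2] at h1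
  rcases h3.eq_or_lt with h0 | h0
  · simp [← h0]
  · by_contra! hc
    nlinarith

/-- The sum `∑ X_s η_s` of the actions weighted by the noise of a history. -/
def noiseSum (θ : Vec d) (h : History d M t) : Vec d :=
  ∑ s, ((h s).2.2 - inner ℝ (h s).2.1 θ) • (h s).2.1

/-- The normal equations `G (θ̂ - θ) = S`, tested against `y`. -/
lemma sum_inner_thetaHat_sub (θ : Vec d) (h : History d M t) (hG : IsUnit (gram h)) (y : Vec d) :
    ∑ s, inner ℝ (h s).2.1 (thetaHat h - θ) * inner ℝ (h s).2.1 y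
      = inner ℝ (noiseSum θ h) y := by
  have h1 : thetaHat h = gramInv h (∑ s, (h s).2.2 • (h s).2.1) := by
    simp [thetaHat, gramInv]
  have h2 := inner_eq_sum_gramInv h hG (∑ s, (h s).2.2 • (h s).2.1) y
  simp only [inner_sub_right, sub_mul, Finset.sum_sub_distrib]
  rw [h1, ← h2]
  simp only [noiseSum, sum_inner, inner_smul_left, sub_mul, Finset.sum_sub_distrib, RCLike.conj_to_real]

/-- Optimism: on the confidence ellipsoid the index of `y` is at least its true mean, and that of
`x` exceeds its true mean by at most twice its width term. -/
lemma gap_le_of_ucbIndex_le (θ : Vec d) (h : History d M t) (hG : IsUnit (gram h)) {b : ℝ}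
    (hgood : energy h (thetaHat h - θ) ≤ b) {x y : Vec d}
    (hxy : ucbIndex h b y ≤ ucbIndex h b x) :
    inner ℝ y θ - inner ℝ x θ ≤ 2 * (wnorm (gram h)⁻¹ x * Real.sqrt b) := by
  have key : ∀ z : Vec d, |inner ℝ z (thetaHat h - θ)| ≤ wnorm (gram h)⁻¹ z * Real.sqrt b :=
    fun z => (abs_inner_le_wnorm_mul h hG z _).trans
      (mul_le_mul_of_nonneg_left (Real.sqrt_le_sqrt hgood) (wnorm_nonneg _ _))
  have hx := (abs_le.1 (key x)).2
  have hy := (abs_le.1 (key y)).1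
  rw [inner_sub_right] at hx hy
  simp only [ucbIndex] at hxy
  linarith

/-! ### The confidence ellipsoid from finitely many directions -/

lemma energy_le_card_mul (h : History d M t) (hX : ∀ s, ‖(h s).2.1‖ ≤ 1) (y : Vec d) :
    energy h y ≤ t * ‖y‖ ^ 2 := by
  calc energy h y ≤ ∑ _s : Fin t, ‖y‖ ^ 2 := by
        refine Finset.sum_le_sum fun s _ => ?_
        rw [sq_le_sq, abs_norm]
        refine (abs_real_inner_le_norm _ _).trans ?_
        exact mul_le_of_le_one_left (norm_nonneg _) (hX s)
    _ = t * ‖y‖ ^ 2 := by simp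

/-- The vector with coordinates `j i / t`. -/
def gridPoint (t : ℕ) (j : Fin d → ℤ) : Vec d := WithLp.toLp 2 fun i => (j i : ℝ) / t

/-- The indices of the grid points of mesh `1 / t` in the cube of side `2 t ^ 2`. -/
def grid (d t : ℕ) : Finset (Fin d → ℤ) :=
  Fintype.piFinset fun _ => Finset.Icc (-(t ^ 3 : ℤ)) (t ^ 3)

lemma card_grid (d t : ℕ) : (grid d t).card = (2 * t ^ 3 + 1) ^ d := by
  simp only [grid, Fintype.card_piFinset, Int.card_Icc, Finset.prod_const, Finset.card_univ,
    Fintype.card_fin]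
  congr 1
  have : (t : ℤ) ^ 3 + 1 - -(t : ℤ) ^ 3 = ((2 * t ^ 3 + 1 : ℕ) : ℤ) := by push_cast; ring
  rw [this, Int.toNat_natCast]

lemma norm_sq_le_of_abs_le {y : Vec d} {r : ℝ} (hy : ∀ i, |y i| ≤ r) :
    ‖y‖ ^ 2 ≤ d * r ^ 2 := by
  rw [EuclideanSpace.norm_sq_eq]
  calc ∑ i, ‖y i‖ ^ 2 ≤ ∑ _i : Fin d, r ^ 2 :=
        Finset.sum_le_sum fun i _ => pow_le_pow_left₀ (norm_nonneg _) (hy i) 2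
    _ = d * r ^ 2 := by simp

/-- Since `G e = S` for the error `e`, completing the square gives `Q(e) = Q(g - e) + 2 (⟨S, g⟩ -
Q(g) / 2)` for every `g`. For a grid point `g` near `e` the first term is at most `1` and the second
at most `2a`. -/
lemma energy_thetaHat_sub_le (θ : Vec d) (h : History d M t) (hX : ∀ s, ‖(h s).2.1‖ ≤ 1)
    {l a : ℝ} (hl : 0 < l) (hle : ∀ y, l * ‖y‖ ^ 2 ≤ energy h y) (ht : 0 < t)
    (ha : a ≤ t / 2) (hdt : (d : ℝ) ≤ l * t) (hdt' : (d : ℝ) ≤ t)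
    (hgrid : ∀ j ∈ grid d t, inner ℝ (noiseSum θ h) (gridPoint t j)
      - energy h (gridPoint t j) / 2 ≤ a) :
    energy h (thetaHat h - θ) ≤ 2 * a + 1 := by
  have hG : IsUnit (gram h) := isUnit_gram h fun y hy =>
    lt_of_lt_of_le (by have := norm_pos_iff.2 hy; positivity) (hle y)
  have ht0 : (0 : ℝ) < t := by exact_mod_cast ht
  have ht1 : (1 : ℝ) ≤ t := by exact_mod_cast ht
  have htz : (1 : ℤ) ≤ t := by exact_mod_cast ht
  set e := thetaHat h - θ with he
  set S := noiseSum θ h with hS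
  -- the coordinates of the noise sum
  have hcoord : ∀ (i : Fin d) (σ : ℤ), (σ = 1 ∨ σ = -1) → σ * S i ≤ t := by
    intro i σ hσ
    have hσ2 : ((σ : ℝ)) ^ 2 = 1 := by rcases hσ with rfl | rfl <;> norm_num
    -- The vectors `±e_i` are themselves grid points, with energy at most `t`; the grid hypothesis
    -- there gives `±S_i ≤ a + t / 2 ≤ t`.
    have hp : gridPoint t (Pi.single i (σ * t)) = EuclideanSpace.single i (σ : ℝ) := by
      ext k
      by_cases hk : k = i
      · subst hk
        simp [gridPoint]
        field_simp
      · simp [gridPoint, hk]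
    have hmem : (Pi.single i (σ * t) : Fin d → ℤ) ∈ grid d t := by
      have htt : (t : ℤ) ≤ (t : ℤ) ^ 3 := le_self_pow₀ htz (by norm_num)
      simp only [grid, Fintype.mem_piFinset, Finset.mem_Icc]
      intro k
      by_cases hk : k = i
      · subst hk
        rcases hσ with rfl | rfl <;> simp <;> constructor <;> linarith
      · simp [hk]
    have h1 := hgrid _ hmem
    rw [hp] at h1
    have h2 := energy_le_card_mul h hX (EuclideanSpace.single i (σ : ℝ))
    have h3 : ‖(EuclideanSpace.single i (σ : ℝ) : Vec d)‖ ^ 2 = 1 := by simp [hσ2]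
    rw [h3] at h2
    have h4 : inner ℝ S (EuclideanSpace.single i (σ : ℝ)) = σ * S i := by
      rw [EuclideanSpace.inner_single_right]
      simp
    rw [h4] at h1
    linarith
  have hSn : ‖S‖ ^ 2 ≤ d * (t : ℝ) ^ 2 := norm_sq_le_of_abs_le fun i => by
    have h1 := hcoord i 1 (Or.inl rfl)
    have h2 := hcoord i (-1) (Or.inr rfl)
    push_cast at h1 h2
    exact abs_le.2 ⟨by linarith, by linarith⟩
  have hen : energy h e = inner ℝ S e := by
    rw [← sum_inner_thetaHat_sub θ h hG e]
    exact Finset.sum_congr rfl fun s _ => sq _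
  have heS : l * ‖e‖ ≤ ‖S‖ := by
    have h1 := hle e
    have h2 : inner ℝ S e ≤ ‖S‖ * ‖e‖ := real_inner_le_norm _ _
    rcases (norm_nonneg e).eq_or_lt with h0 | h0
    · simp [← h0]
    · by_contra! hc
      nlinarith
  -- An a priori bound that puts the error inside the cube covered by the grid: `l ‖e‖ ≤ ‖S‖ ≤ d t`
  -- and `d ≤ l t`.
  have hebd : ‖e‖ ≤ (t : ℝ) ^ 2 := by
    have hd : (d : ℝ) ≤ (d : ℝ) ^ 2 := by exact_mod_cast Nat.le_self_pow (by norm_num) d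
    have h1 : ‖S‖ ≤ d * t := by
      refine abs_le_of_sq_le_sq' ?_ (by positivity) |>.2
      calc ‖S‖ ^ 2 ≤ d * (t : ℝ) ^ 2 := hSn
        _ ≤ (d : ℝ) ^ 2 * (t : ℝ) ^ 2 := by gcongr
        _ = _ := by ring
    have h2 : l * ‖e‖ ≤ l * (t : ℝ) ^ 2 := by
      calc l * ‖e‖ ≤ d * t := heS.trans h1
        _ ≤ l * t * t := by gcongr
        _ = _ := by ring
    exact le_of_mul_le_mul_left h2 hl
  -- the grid point below the error vector
  set j : Fin d → ℤ := fun i => ⌊t * e i⌋ with hj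
  have hei : ∀ i, |e i| ≤ (t : ℝ) ^ 2 := fun i => (PiLp.norm_apply_le e i).trans hebd
  have hmem : j ∈ grid d t := by
    simp only [grid, Fintype.mem_piFinset, Finset.mem_Icc, hj]
    intro i
    have := abs_le.1 (hei i)
    constructor
    · rw [Int.le_floor]
      push_cast
      nlinarith
    · have h1 : (⌊t * e i⌋ : ℝ) ≤ (t : ℝ) ^ 3 := (Int.floor_le _).trans (by nlinarith)
      exact_mod_cast h1
  have hdiff : ‖gridPoint t j - e‖ ^ 2 ≤ d * (1 / (t : ℝ)) ^ 2 := by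
    refine norm_sq_le_of_abs_le fun i => ?_
    have h1 := Int.floor_le (t * e i)
    have h2 := Int.lt_floor_add_one (t * e i)
    have h3 : (gridPoint t j - e) i = ((⌊t * e i⌋ : ℝ) - t * e i) / t := by
      simp [gridPoint, hj]
      field_simp
    rw [h3, abs_div, abs_of_pos ht0]
    gcongr
    exact abs_le.2 ⟨by linarith, by linarith⟩
  -- Rounding moves each coordinate by at most `1 / t`, which costs energy at most `t · d / t² = d /
  -- t`.
  have hQ : energy h (gridPoint t j - e) ≤ 1 := by
    calc energy h (gridPoint t j - e) ≤ t * (d * (1 / (t : ℝ)) ^ 2) :=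
          (energy_le_card_mul h hX _).trans (by gcongr)
      _ = d / t := by field_simp
      _ ≤ 1 := by rw [div_le_one ht0]; exact hdt'
  have hpol : energy h (gridPoint t j - e) = energy h (gridPoint t j)
      - 2 * inner ℝ S (gridPoint t j) + energy h e := by
    rw [← sum_inner_thetaHat_sub θ h hG, ← he]
    simp only [energy, inner_sub_right, Finset.mul_sum, ← Finset.sum_sub_distrib,
      ← Finset.sum_add_distrib]
    exact Finset.sum_congr rfl fun s _ => by ring
  have := hgrid j hmem
  linarith

end Energy

/-! ### Quantitative spanning -/

section Spanning

variable {d : ℕ}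

/-- A vector orthogonal to a spanning family vanishes, so `y ↦ (⟨v i, y⟩)_i` is injective; in finite
dimension it is then bounded below. -/
lemma exists_norm_sq_le_of_span {ι : Type*} [Fintype ι] (v : ι → Vec d)
    (hv : Submodule.span ℝ (Set.range v) = ⊤) :
    ∃ c > 0, ∀ y, c * ‖y‖ ^ 2 ≤ ∑ i, inner ℝ (v i) y ^ 2 := by
  let T : Vec d →ₗ[ℝ] EuclideanSpace ℝ ι :=
    (WithLp.linearEquiv 2 ℝ (ι → ℝ)).symm.toLinearMap ∘ₗ
      LinearMap.pi fun i => (innerSL ℝ (v i)).toLinearMap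
  have hT : ∀ y i, T y i = inner ℝ (v i) y := fun y i => rfl
  have hker : LinearMap.ker T = ⊥ := by
    rw [LinearMap.ker_eq_bot']
    intro y hy
    have h1 : ∀ x ∈ Submodule.span ℝ (Set.range v), inner ℝ x y = 0 := by
      intro x hx
      induction hx using Submodule.span_induction with
      | mem x hx => obtain ⟨i, rfl⟩ := hx; rw [← hT, hy]; rfl
      | zero => simp
      | add a b _ _ ha hb => rw [inner_add_left, ha, hb, add_zero]
      | smul a x _ hx => rw [inner_smul_left, hx, mul_zero]
    have := h1 y (hv ▸ Submodule.mem_top)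
    exact inner_self_eq_zero.1 this
  obtain ⟨K, hK, hT'⟩ := T.exists_antilipschitzWith hker
  have hK' : (0 : ℝ) < K := hK
  refine ⟨1 / (K : ℝ) ^ 2, by positivity, fun y => ?_⟩
  have h1 := hT'.le_mul_dist y 0
  rw [map_zero, dist_zero_right, dist_zero_right] at h1
  have h2 : ‖T y‖ ^ 2 = ∑ i, inner ℝ (v i) y ^ 2 := by
    rw [EuclideanSpace.norm_sq_eq]
    exact Finset.sum_congr rfl fun i _ => by rw [hT, Real.norm_eq_abs, sq_abs]
  rw [← h2, one_div, inv_mul_le_iff₀ (by positivity), ← mul_pow]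
  exact pow_le_pow_left₀ (norm_nonneg _) h1 2

lemma exists_forall_finset_pos {α : Type*} (s : Finset α) (P : α → ℝ → Prop)
    (hP : ∀ a ∈ s, ∃ c > 0, ∀ r, 0 < r → r ≤ c → P a r) : ∃ c > 0, ∀ a ∈ s, P a c := by
  have h1 : ∀ᶠ c in nhdsWithin (0 : ℝ) (Set.Ioi 0), ∀ a ∈ s, P a c := by
    rw [Filter.eventually_all_finset]
    intro a ha
    obtain ⟨c, hc, h⟩ := hP a ha
    filter_upwards [Ioc_mem_nhdsGT hc] with r hr using h r hr.1 hr.2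
  obtain ⟨c, h2, h3⟩ := (h1.and self_mem_nhdsWithin).exists
  exact ⟨c, h3, h2⟩

/-- Only finitely many families take values in `A`, so one constant serves them all. The families
used later depend on the sample, which makes this uniformity necessary. -/
lemma exists_norm_sq_le_of_span_finset {ι : Type*} [Fintype ι] [DecidableEq ι]
    (A : Finset (Vec d)) :
    ∃ c > 0, ∀ v : ι → Vec d, (∀ i, v i ∈ A) → Submodule.span ℝ (Set.range v) = ⊤ →
      ∀ y, c * ‖y‖ ^ 2 ≤ ∑ i, inner ℝ (v i) y ^ 2 := by
  classical
  obtain ⟨c, hc, h⟩ := exists_forall_finset_pos (Fintype.piFinset fun _ : ι => A)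
    (fun v c => Submodule.span ℝ (Set.range v) = ⊤ →
      ∀ y, c * ‖y‖ ^ 2 ≤ ∑ i, inner ℝ (v i) y ^ 2) (by
    intro v _
    by_cases hv : Submodule.span ℝ (Set.range v) = ⊤
    · obtain ⟨c, hc, h⟩ := exists_norm_sq_le_of_span v hv
      exact ⟨c, hc, fun r _ hr _ y => le_trans (by gcongr) (h y)⟩
    · exact ⟨1, one_pos, fun _ _ _ h => absurd h hv⟩)
  exact ⟨c, hc, fun v hvA => h v (Fintype.mem_piFinset.2 hvA)⟩

end Spanning

/-! ### Exponential supermartingales on a product space -/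

section Update

variable {Ω : Type*} [MeasurableSpace Ω] (ν : Measure Ω) [IsProbabilityMeasure ν]

/-- Resampling one coordinate independently keeps the product law. This replaces conditional
expectations given the past. -/
lemma measurePreserving_update_infinitePi (t : ℕ) :
    MeasurePreserving (fun q : (ℕ → Ω) × Ω => Function.update q.1 t q.2)
      ((Measure.infinitePi fun _ : ℕ => ν).prod ν) (Measure.infinitePi fun _ : ℕ => ν) := by
  classical
  have hm : Measurable (fun q : (ℕ → Ω) × Ω => Function.update q.1 t q.2) := by
    rw [measurable_pi_iff]
    intro s
    by_cases hs : s = t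
    · subst hs; simpa using measurable_snd
    · simp only [Function.update_of_ne hs]
      exact (measurable_pi_apply s).comp measurable_fst
  refine ⟨hm, ?_⟩
  refine Measure.eq_infinitePi _ fun s A hA => ?_
  rw [Measure.map_apply hm (MeasurableSet.pi s.countable_toSet fun i _ => hA i)]
  by_cases hts : t ∈ s
  · have hpre : (fun q : (ℕ → Ω) × Ω => Function.update q.1 t q.2) ⁻¹' (s : Set ℕ).pi A
        = ((s.erase t : Finset ℕ) : Set ℕ).pi A ×ˢ A t := by
      ext q
      simp only [Set.mem_preimage, Set.mem_pi, Set.mem_prod, Finset.mem_coe, Finset.mem_erase]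
      constructor
      · intro h
        refine ⟨fun i hi => by simpa [Function.update_of_ne hi.1] using h i hi.2,
          by simpa using h t hts⟩
      · rintro ⟨h1, h2⟩ i hi
        by_cases hit : i = t
        · subst hit; simpa using h2
        · simpa [Function.update_of_ne hit] using h1 i ⟨hit, hi⟩
    rw [hpre, Measure.prod_prod, Measure.infinitePi_pi _ (fun i _ => hA i),
      Finset.prod_erase_mul _ _ hts]
  · have hpre : (fun q : (ℕ → Ω) × Ω => Function.update q.1 t q.2) ⁻¹' (s : Set ℕ).pi A
        = (s : Set ℕ).pi A ×ˢ Set.univ := by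
      ext q
      simp only [Set.mem_preimage, Set.mem_pi, Set.mem_prod, Finset.mem_coe, Set.mem_univ, and_true]
      refine forall₂_congr fun i hi => ?_
      rw [Function.update_of_ne (by rintro rfl; exact hts hi)]
    rw [hpre, Measure.prod_prod, Measure.infinitePi_pi _ (fun i _ => hA i), measure_univ, mul_one]

/-- After coordinate `t` is resampled, `F` and `g` are unchanged as functions of the past, and
Tonelli integrates out the fresh coordinate first. -/
lemma lintegral_mul_le_of_dependsOn (t : ℕ) {F : (ℕ → Ω) → ENNReal} (hF : Measurable F)
    (hFd : DependsOn F (Set.Iio t)) {g : (ℕ → Ω) → Ω → ENNReal}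
    (hg : Measurable (Function.uncurry g)) (hgd : DependsOn g (Set.Iio t))
    (hle : ∀ ω, ∫⁻ z, g ω z ∂ν ≤ 1) :
    ∫⁻ ω, F ω * g ω (ω t) ∂(Measure.infinitePi fun _ : ℕ => ν)
      ≤ ∫⁻ ω, F ω ∂(Measure.infinitePi fun _ : ℕ => ν) := by
  have hmeas : Measurable fun ω : ℕ → Ω => F ω * g ω (ω t) :=
    hF.mul (hg.comp (measurable_id.prodMk (measurable_pi_apply t)))
  have hupd : ∀ (ω : ℕ → Ω) (z : Ω), ∀ i ∈ Set.Iio t, Function.update ω t z i = ω i :=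
    fun ω z i hi => Function.update_of_ne (ne_of_lt hi) _ _
  rw [← (measurePreserving_update_infinitePi ν t).lintegral_comp hmeas]
  have h1 : ∀ q : (ℕ → Ω) × Ω, F (Function.update q.1 t q.2) *
      g (Function.update q.1 t q.2) (Function.update q.1 t q.2 t) = F q.1 * g q.1 q.2 := by
    intro q
    rw [hFd (hupd q.1 q.2), hgd (hupd q.1 q.2), Function.update_self]
  simp only [h1]
  have hprod : Measurable fun q : (ℕ → Ω) × Ω => F q.1 * g q.1 q.2 :=
    (hF.comp measurable_fst).mul hg
  rw [lintegral_prod _ hprod.aemeasurable]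
  refine lintegral_mono fun ω => ?_
  simp only
  have hgω : Measurable (g ω) := hg.comp measurable_prodMk_left
  rw [lintegral_const_mul _ hgω]
  exact mul_le_of_le_one_right' (hle ω)

/-- A product of nonnegative factors, each with conditional mean at most one given the past,
has mean at most one. -/
lemma lintegral_prod_le_one (g : ℕ → (ℕ → Ω) → Ω → ENNReal)
    (hg : ∀ t, Measurable (Function.uncurry (g t))) (hgd : ∀ t, DependsOn (g t) (Set.Iio t))
    (hle : ∀ t ω, ∫⁻ z, g t ω z ∂ν ≤ 1) (t : ℕ) :
    ∫⁻ ω, ∏ s ∈ Finset.range t, g s ω (ω s) ∂(Measure.infinitePi fun _ : ℕ => ν) ≤ 1 := by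
  induction t with
  | zero => simp
  | succ t ih =>
    simp only [Finset.prod_range_succ]
    refine (lintegral_mul_le_of_dependsOn ν t ?_ ?_ (hg t) (hgd t) (hle t)).trans ih
    · exact Finset.measurable_prod _ fun s _ =>
        (hg s).comp (measurable_id.prodMk (measurable_pi_apply s))
    · intro ω ω' h
      refine Finset.prod_congr rfl fun s hs => ?_
      have hs' : s < t := Finset.mem_range.1 hs
      rw [hgd s (fun i hi => h i (lt_trans hi hs')), h s hs']

/-- The Chernoff bound for sums of increments `f s ω (ω s)` whose exponentials have conditional
mean at most one given the past. -/
lemma measure_le_sum_le_exp (f : ℕ → (ℕ → Ω) → Ω → ℝ)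
    (hf : ∀ t, Measurable (Function.uncurry (f t))) (hfd : ∀ t, DependsOn (f t) (Set.Iio t))
    (hle : ∀ t ω, ∫⁻ z, ENNReal.ofReal (Real.exp (f t ω z)) ∂ν ≤ 1) (t : ℕ) (a : ℝ) :
    (Measure.infinitePi fun _ : ℕ => ν) {ω | a ≤ ∑ s ∈ Finset.range t, f s ω (ω s)}
      ≤ ENNReal.ofReal (Real.exp (-a)) := by
  have h1 := lintegral_prod_le_one ν (fun t ω z => ENNReal.ofReal (Real.exp (f t ω z)))
    (fun t => (Real.measurable_exp.comp (hf t)).ennreal_ofReal)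
    (fun t ω ω' h => by simp only [hfd t h]) hle t
  have h2 : ∀ ω : ℕ → Ω, ∏ s ∈ Finset.range t, ENNReal.ofReal (Real.exp (f s ω (ω s)))
      = ENNReal.ofReal (Real.exp (∑ s ∈ Finset.range t, f s ω (ω s))) := by
    intro ω
    rw [Real.exp_sum, ENNReal.ofReal_prod_of_nonneg fun _ _ => (Real.exp_pos _).le]
  simp only [h2] at h1
  have hm : Measurable fun ω : ℕ → Ω => ∑ s ∈ Finset.range t, f s ω (ω s) :=
    Finset.measurable_sum _ fun s _ => (hf s).comp (measurable_id.prodMk (measurable_pi_apply s))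
  have h3 := mul_meas_ge_le_lintegral (μ := Measure.infinitePi fun _ : ℕ => ν)
    (Real.measurable_exp.comp hm).ennreal_ofReal (ENNReal.ofReal (Real.exp a))
  have h4 : {ω : ℕ → Ω | a ≤ ∑ s ∈ Finset.range t, f s ω (ω s)} ⊆
      {ω | ENNReal.ofReal (Real.exp a) ≤
        ENNReal.ofReal ((Real.exp ∘ fun ω : ℕ → Ω => ∑ s ∈ Finset.range t, f s ω (ω s)) ω)} :=
    fun ω hω => ENNReal.ofReal_le_ofReal (Real.exp_le_exp.2 hω)
  have h5 := (mul_le_mul_right (measure_mono h4) (ENNReal.ofReal (Real.exp a))).trans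
    (h3.trans h1)
  rw [Real.exp_neg, ENNReal.ofReal_inv_of_pos (Real.exp_pos a)]
  rw [← one_div, ENNReal.le_div_iff_mul_le (by simp [Real.exp_pos]) (by simp), mul_comm]
  exact h5

end Update

/-! ### Concentration of the noise and of the context counts -/

section Interaction

variable {d M K : ℕ} (B : Bandit d M K) (π : Policy d M)

/-- The law of the primitive randomness of a single round. -/
def roundLaw : Measure (Fin M × ℝ × unitInterval) :=
  B.p.toMeasure.prod ((gaussianReal 0 1).prod (volume : Measure unitInterval))

instance : IsProbabilityMeasure (roundLaw B) := by unfold roundLaw; infer_instance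

lemma law_eq : B.law = Measure.infinitePi fun _ : ℕ => roundLaw B := rfl

instance : IsProbabilityMeasure B.law := by rw [law_eq]; infer_instance

lemma history_apply (t : ℕ) (ω : Sample M) (s : Fin t) :
    B.history π t ω s = ((ω s).1, B.action π s ω, B.reward π s ω) := by
  induction t with
  | zero => exact s.elim0
  | succ t ih =>
    refine Fin.lastCases ?_ (fun s => ?_) s
    · simp [Bandit.history, Bandit.action, Bandit.reward]
    · simp [Bandit.history, ih]

lemma dependsOn_history (t : ℕ) : DependsOn (B.history π t) (Set.Iio t) := by
  induction t with
  | zero => intro ω ω' _; exact Subsingleton.elim _ _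
  | succ t ih =>
    intro ω ω' h
    have h1 := ih fun i hi => h i (lt_trans hi (Nat.lt_succ_self t))
    simp only [Bandit.history, h1, h t (Nat.lt_succ_self t)]

lemma measurable_history (t : ℕ) : Measurable (B.history π t) := by
  induction t with
  | zero => exact measurable_const
  | succ t ih =>
    have hz : Measurable fun ω : Sample M => ω t := measurable_pi_apply t
    have hx : Measurable fun ω : Sample M =>
        π.select t (B.history π t ω) (ω t).1 (ω t).2.2 :=
      (π.measurable_select t).comp (ih.prodMk (hz.fst.prodMk hz.snd.snd))
    rw [measurable_pi_iff]
    intro s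
    refine Fin.lastCases ?_ (fun s => ?_) s
    · simp only [Bandit.history, Fin.snoc_last]
      exact hz.fst.prodMk (hx.prodMk ((hx.inner measurable_const).add hz.snd.fst))
    · simp only [Bandit.history, Fin.snoc_castSucc]
      exact (measurable_pi_apply s).comp ih

lemma measurable_action (t : ℕ) : Measurable (B.action π t) := by
  have hz : Measurable fun ω : Sample M => ω t := measurable_pi_apply t
  exact (π.measurable_select t).comp
    ((measurable_history B π t).prodMk (hz.fst.prodMk hz.snd.snd))

lemma lintegral_exp_gaussian (a : ℝ) :
    ∫⁻ x, ENNReal.ofReal (Real.exp (a * x - a ^ 2 / 2)) ∂(gaussianReal 0 1) = 1 := by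
  have h1 : ∫ x, Real.exp (a * x) ∂(gaussianReal 0 1) = Real.exp (a ^ 2 / 2) := by
    have := congrFun (mgf_id_gaussianReal (μ := 0) (v := 1)) a
    simpa [mgf] using this
  have h2 : Integrable (fun x => Real.exp (a * x)) (gaussianReal 0 1) :=
    integrable_exp_mul_gaussianReal a
  rw [← ofReal_integral_eq_lintegral_ofReal]
  · simp only [Real.exp_sub, integral_div, h1]
    simp [(Real.exp_pos _).ne']
  · simp only [Real.exp_sub]
    exact h2.div_const _
  · exact ae_of_all _ fun _ => (Real.exp_pos _).le

lemma energy_history (t : ℕ) (ω : Sample M) (y : Vec d) :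
    energy (B.history π t ω) y = ∑ s ∈ Finset.range t, inner ℝ (B.action π s ω) y ^ 2 := by
  rw [Finset.sum_range]
  simp [energy, history_apply]

lemma inner_noiseSum_history (t : ℕ) (ω : Sample M) (y : Vec d) :
    inner ℝ (noiseSum B.θ (B.history π t ω)) y
      = ∑ s ∈ Finset.range t, (ω s).2.1 * inner ℝ (B.action π s ω) y := by
  rw [Finset.sum_range]
  simp [noiseSum, history_apply, sum_inner, inner_smul_left, Bandit.reward]

/-- Given the past, the context and the seed, the action is fixed and the noise is still standard
Gaussian, so each factor `exp(a η - a² / 2)` with `a = ⟨X_t, y⟩` has mean one. -/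
lemma measure_le_inner_noiseSum_sub_energy (t : ℕ) (y : Vec d) (a : ℝ) :
    B.law {ω | a ≤ inner ℝ (noiseSum B.θ (B.history π t ω)) y - energy (B.history π t ω) y / 2}
      ≤ ENNReal.ofReal (Real.exp (-a)) := by
  let f : ℕ → Sample M → Fin M × ℝ × unitInterval → ℝ := fun t ω z =>
    inner ℝ (π.select t (B.history π t ω) z.1 z.2.2) y * z.2.1
      - inner ℝ (π.select t (B.history π t ω) z.1 z.2.2) y ^ 2 / 2
  have hx : ∀ t, Measurable fun q : Sample M × Fin M × ℝ × unitInterval =>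
      (inner ℝ (π.select t (B.history π t q.1) q.2.1 q.2.2.2) y : ℝ) := fun t =>
    ((π.measurable_select t).comp (((measurable_history B π t).comp measurable_fst).prodMk
      (measurable_snd.fst.prodMk measurable_snd.snd.snd))).inner measurable_const
  have key := measure_le_sum_le_exp (roundLaw B) f ?_ ?_ ?_ t a
  · rw [law_eq]
    refine le_trans (measure_mono fun ω hω => ?_) key
    simp only [Set.mem_ofPred_eq] at hω ⊢
    rw [inner_noiseSum_history, energy_history, Finset.sum_div, ← Finset.sum_sub_distrib] at hω
    refine hω.trans (le_of_eq (Finset.sum_congr rfl fun s _ => ?_))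
    simp only [f, Bandit.action]
    ring
  · intro t
    exact ((hx t).mul measurable_snd.snd.fst).sub (((hx t).pow_const 2).div_const 2)
  · intro t ω ω' h
    simp only [f, dependsOn_history B π t h]
  · intro t ω
    have hm : Measurable fun z : Fin M × ℝ × unitInterval => ENNReal.ofReal (Real.exp (f t ω z)) := by
      have hx' := (hx t).comp (measurable_prodMk_left (x := ω))
      exact (Real.measurable_exp.comp ((hx'.mul measurable_snd.fst).sub
        ((hx'.pow_const 2).div_const 2))).ennreal_ofReal
    rw [roundLaw, lintegral_prod _ hm.aemeasurable]
    have hone : ∀ m : Fin M, ∫⁻ w, ENNReal.ofReal (Real.exp (f t ω (m, w)))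
        ∂((gaussianReal 0 1).prod (volume : Measure unitInterval)) = 1 := by
      intro m
      have hm' : Measurable fun w : ℝ × unitInterval =>
          ENNReal.ofReal (Real.exp (f t ω (m, w))) := hm.comp measurable_prodMk_left
      rw [lintegral_prod_symm _ hm'.aemeasurable]
      simp only [f, lintegral_exp_gaussian]
      simp
    simp [hone]

/-- The number of occurrences of a context in the first `t` rounds. -/
def contextCount (m : Fin M) (t : ℕ) (ω : Sample M) : ℕ :=
  Finset.card {s ∈ Finset.range t | (ω s).1 = m}

/-- Chernoff with increments `p / 2 - 1{c = m}`: as `e⁻¹ ≤ 1 / 2`, their exponential moment is at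
most `e^(p/2) (1 - p / 2) ≤ 1`. A count below `p t / 4` forces their sum above `p t / 4`. -/
lemma measure_contextCount_le (m : Fin M) (t : ℕ) :
    B.law {ω | (contextCount m t ω : ℝ) ≤ (B.p m).toReal / 4 * t}
      ≤ ENNReal.ofReal (Real.exp (-((B.p m).toReal / 4 * t))) := by
  set p := (B.p m).toReal with hp
  let f : ℕ → Sample M → Fin M × ℝ × unitInterval → ℝ := fun _ _ z =>
    p / 2 - if z.1 = m then 1 else 0
  have hmz : Measurable fun z : Fin M × ℝ × unitInterval => p / 2 - if z.1 = m then (1 : ℝ) else 0 :=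
    measurable_const.sub
      ((Measurable.of_discrete (f := fun c : Fin M => if c = m then (1 : ℝ) else 0)).comp
        measurable_fst)
  have key := measure_le_sum_le_exp (roundLaw B) f ?_ ?_ ?_ t (p / 4 * t)
  · rw [law_eq]
    refine le_trans (measure_mono fun ω hω => ?_) key
    simp only [Set.mem_ofPred_eq] at hω ⊢
    simp only [f, Finset.sum_sub_distrib, Finset.sum_boole, Finset.sum_const, Finset.card_range,
      nsmul_eq_mul]
    simp only [contextCount] at hω
    linarith
  · intro t
    exact hmz.comp measurable_snd
  · intro t ω ω' h
    rfl
  · intro t ω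
    have hprob : IsProbabilityMeasure ((gaussianReal 0 1).prod (volume : Measure unitInterval)) :=
      inferInstance
    have hm1 : Measurable fun z : Fin M × ℝ × unitInterval =>
        ENNReal.ofReal (Real.exp (f t ω z)) := (Real.measurable_exp.comp hmz).ennreal_ofReal
    rw [roundLaw, lintegral_prod _ hm1.aemeasurable]
    have hinner : ∀ c : Fin M, ∫⁻ w, ENNReal.ofReal (Real.exp (f t ω (c, w)))
        ∂((gaussianReal 0 1).prod (volume : Measure unitInterval))
          = ENNReal.ofReal (Real.exp (p / 2 - if c = m then 1 else 0)) := by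
      intro c
      change ∫⁻ _, ENNReal.ofReal (Real.exp (p / 2 - if c = m then 1 else 0)) ∂_ = _
      rw [lintegral_const, hprob.measure_univ, mul_one]
    simp only [hinner]
    have hint : ∀ g : Fin M → ℝ, Integrable g B.p.toMeasure := fun g => Integrable.of_finite
    rw [← ofReal_integral_eq_lintegral_ofReal (hint _) (ae_of_all _ fun _ => (Real.exp_pos _).le)]
    rw [← ENNReal.ofReal_one]
    refine ENNReal.ofReal_le_ofReal ?_
    have hexp : Real.exp (-1) ≤ 1 / 2 := by
      have := Real.add_one_le_exp (1 : ℝ)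
      rw [Real.exp_neg, ← one_div]
      exact one_div_le_one_div_of_le (by norm_num) (by linarith)
    calc ∫ c, Real.exp (p / 2 - if c = m then 1 else 0) ∂B.p.toMeasure
        ≤ ∫ c, Real.exp (p / 2) * (1 - if c = m then 1 / 2 else 0) ∂B.p.toMeasure := by
          refine integral_mono (hint _) (hint _) fun c => ?_
          by_cases hc : c = m
          · simp only [hc, if_true, sub_eq_add_neg, Real.exp_add]
            have := Real.exp_pos (p / 2)
            nlinarith
          · simp [hc]
      _ = Real.exp (p / 2) * (1 - p / 2) := by
          rw [integral_const_mul, integral_sub (hint _) (hint _)]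
          rw [PMF.integral_eq_sum B.p (fun c => if c = m then (1 / 2 : ℝ) else 0)]
          simp [← hp]
          ring
      _ ≤ Real.exp (p / 2) * Real.exp (-(p / 2)) := by
          gcongr
          exact Real.one_sub_le_exp_neg _
      _ = 1 := by rw [← Real.exp_add]; simp

end Interaction

/-! ### Gaps and the behaviour of LinUCB -/

section LinUCB

variable {d M K : ℕ} (B : Bandit d M K)

/-- The finite set of all actions of all contexts. -/
def Bandit.allActions : Finset (Vec d) := by
  classical exact Finset.univ.biUnion B.actions

variable {B} in
lemma mem_allActions {m : Fin M} {x : Vec d} (hx : x ∈ B.actions m) : x ∈ B.allActions := by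
  classical
  simp only [Bandit.allActions, Finset.mem_biUnion]
  exact ⟨m, Finset.mem_univ m, hx⟩

lemma inner_le_optValue {m : Fin M} {x : Vec d} (hx : x ∈ B.actions m) :
    inner ℝ x B.θ ≤ B.optValue m :=
  le_ciSup (f := fun x : B.actions m => (inner ℝ (x : Vec d) B.θ : ℝ))
    (Set.finite_range _).bddAbove ⟨x, hx⟩

lemma isOptimal_of_optValue_le {m : Fin M} {x : Vec d} (hx : x ∈ B.actions m)
    (h : B.optValue m ≤ inner ℝ x B.θ) : B.IsOptimal m x :=
  ⟨hx, fun _ hy => (inner_le_optValue B hy).trans h⟩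

lemma exists_eq_optValue {m : Fin M} (hm : (B.actions m).Nonempty) :
    ∃ x ∈ B.actions m, inner ℝ x B.θ = B.optValue m := by
  obtain ⟨x, hx, hmax⟩ := (B.actions m).exists_max_image (fun x => (inner ℝ x B.θ : ℝ)) hm
  refine ⟨x, hx, le_antisymm (inner_le_optValue B hx) ?_⟩
  have : Nonempty (B.actions m) := ⟨⟨x, hx⟩⟩
  exact ciSup_le fun y => hmax y y.2

lemma exists_gap_pos : ∃ Δ > 0, ∀ m, ∀ x ∈ B.actions m,
    inner ℝ x B.θ < B.optValue m → Δ ≤ B.optValue m - inner ℝ x B.θ := by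
  obtain ⟨c, hc, h⟩ := exists_forall_finset_pos
    ((Finset.univ : Finset (Fin M)) ×ˢ B.allActions) (fun q c =>
      inner ℝ q.2 B.θ < B.optValue q.1 → c ≤ B.optValue q.1 - inner ℝ q.2 B.θ) (by
    intro q _
    by_cases hq : inner ℝ q.2 B.θ < B.optValue q.1
    · exact ⟨_, sub_pos.2 hq, fun r _ hr _ => hr⟩
    · exact ⟨1, one_pos, fun _ _ _ h => absurd h hq⟩)
  exact ⟨c, hc, fun m x hx => h (m, x) (by simp [mem_allActions hx])⟩

lemma exists_prob_pos : ∃ q > 0, ∀ m, q ≤ (B.p m).toReal / 4 := by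
  obtain ⟨c, hc, h⟩ := exists_forall_finset_pos (Finset.univ : Finset (Fin M))
    (fun m c => c ≤ (B.p m).toReal / 4) (fun m _ => ⟨(B.p m).toReal / 4,
      div_pos (ENNReal.toReal_pos (B.p_pos m).ne' (PMF.apply_ne_top _ _)) (by norm_num),
      fun r _ hr => hr⟩)
  exact ⟨c, hc, fun m => h m (Finset.mem_univ m)⟩

variable (π : Policy d M)

lemma energy_history_mono {s t : ℕ} (hst : s ≤ t) (ω : Sample M) (y : Vec d) :
    energy (B.history π s ω) y ≤ energy (B.history π t ω) y := by
  rw [energy_history, energy_history]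
  exact Finset.sum_le_sum_of_subset_of_nonneg (Finset.range_mono hst) fun _ _ _ => sq_nonneg _

variable {B π} {β : ℕ → ℝ} (hπ : π.IsLinUCB B.actions β)
include hπ

lemma action_mem (t : ℕ) (ω : Sample M) : B.action π t ω ∈ B.actions (ω t).1 :=
  (hπ t _ _ _).1

lemma norm_action_le (t : ℕ) (ω : Sample M) : ‖B.action π t ω‖ ≤ 1 :=
  B.norm_le_one _ _ (action_mem hπ t ω)

/-- Each of the first `d` actions lies outside the span of its predecessors and so raises the
dimension. -/
lemma span_initial_actions (ω : Sample M) :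
    Submodule.span ℝ (Set.range fun s : Fin d => B.action π s ω) = ⊤ := by
  have key : ∀ t ≤ d,
      t ≤ Module.finrank ℝ (Submodule.span ℝ (Set.range fun s : Fin t => B.action π s ω)) := by
    intro t
    induction t with
    | zero => simp
    | succ t ih =>
      intro ht
      have h1 := (hπ t (B.history π t ω) (ω t).1 (ω t).2.2).2.1 ht
      simp only [history_apply] at h1
      refine Nat.succ_le_of_lt (lt_of_le_of_lt (ih (by omega)) ?_)
      refine Submodule.finrank_lt_finrank_of_lt (lt_of_le_of_ne ?_ ?_)
      · refine Submodule.span_mono ?_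
        rintro _ ⟨s, rfl⟩
        exact ⟨s.castSucc, rfl⟩
      · intro heq
        apply h1
        rw [heq]
        exact Submodule.subset_span ⟨Fin.last t, rfl⟩
  refine Submodule.eq_top_of_finrank_eq (le_antisymm (Submodule.finrank_le _) ?_)
  simpa using key d le_rfl

-- The first `d` actions already give the bound, and energy only grows. The constant depends on the
-- bandit alone, by finiteness of the action sets.
omit hπ in
lemma exists_energy_lower_bound (B : Bandit d M K) : ∃ l > 0, ∀ (π : Policy d M) (β : ℕ → ℝ),
    π.IsLinUCB B.actions β → ∀ (ω : Sample M) (t : ℕ), d ≤ t →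
      ∀ y, l * ‖y‖ ^ 2 ≤ energy (B.history π t ω) y := by
  obtain ⟨l, hl, h⟩ := exists_norm_sq_le_of_span_finset (ι := Fin d) B.allActions
  refine ⟨l, hl, fun π β hπ ω t ht y => ?_⟩
  refine (h (fun s : Fin d => B.action π s ω) (fun s => mem_allActions (action_mem hπ s ω))
    (span_initial_actions hπ ω) y).trans ?_
  refine le_trans (le_of_eq ?_) (energy_history_mono B π ht ω y)
  rw [energy_history, Finset.sum_range]

lemma isUnit_gram_history (ω : Sample M) {t : ℕ} (ht : d ≤ t) :
    IsUnit (gram (B.history π t ω)) := by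
  obtain ⟨l, hl, h⟩ := exists_energy_lower_bound B
  exact isUnit_gram _ fun y hy => lt_of_lt_of_le
    (by have := norm_pos_iff.2 hy; positivity) (h π β hπ ω t ht y)

lemma gap_sq_le {t : ℕ} (ht : d ≤ t) (ω : Sample M) {Δ : ℝ} (hΔ : 0 < Δ)
    (hβ : 0 ≤ β (t + 1))
    (hgood : energy (B.history π t ω) (thetaHat (B.history π t ω) - B.θ) ≤ β (t + 1))
    (hgap : Δ ≤ B.optValue (ω t).1 - inner ℝ (B.action π t ω) B.θ) :
    Δ ^ 2 ≤ 4 * β (t + 1) * wnorm (gram (B.history π t ω))⁻¹ (B.action π t ω) ^ 2 := by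
  have hG := isUnit_gram_history hπ ω ht
  obtain ⟨x, hx, hopt⟩ := exists_eq_optValue B ⟨_, action_mem hπ t ω⟩
  have h1 := gap_le_of_ucbIndex_le B.θ _ hG hgood
    ((hπ t (B.history π t ω) (ω t).1 (ω t).2.2).2.2 ht hG x hx)
  rw [hopt] at h1
  change _ ≤ 2 * (wnorm (gram (B.history π t ω))⁻¹ (B.action π t ω) * _) at h1
  have h2 := hgap.trans h1
  calc Δ ^ 2 ≤ _ := pow_le_pow_left₀ hΔ.le h2 2
    _ = 4 * β (t + 1) * wnorm (gram (B.history π t ω))⁻¹ (B.action π t ω) ^ 2 := by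
      rw [mul_pow, mul_pow, Real.sq_sqrt hβ]
      ring

/-! ### Play counts of context-action pairs -/

omit hπ

/-- The number of the first `t` rounds in which the context is `m` and `x` is played. -/
def pairCount (B : Bandit d M K) (π : Policy d M) (m : Fin M) (x : Vec d) (t : ℕ)
    (ω : Sample M) : ℕ := by
  classical exact Finset.card {s ∈ Finset.range t | (ω s).1 = m ∧ B.action π s ω = x}

lemma pairCount_le (m : Fin M) (x : Vec d) (t : ℕ) (ω : Sample M) :
    pairCount B π m x t ω ≤ t := by
  classical
  exact (Finset.card_filter_le _ _).trans (by simp)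

open scoped Classical in
lemma pairCount_succ (m : Fin M) (x : Vec d) (t : ℕ) (ω : Sample M) :
    pairCount B π m x (t + 1) ω = pairCount B π m x t ω
      + if (ω t).1 = m ∧ B.action π t ω = x then 1 else 0 := by
  simp only [pairCount, Finset.card_filter, Finset.sum_range_succ]

lemma pairCount_le_card_history (m : Fin M) (x : Vec d) (t : ℕ) (ω : Sample M) :
    pairCount B π m x t ω ≤ Finset.card {s | (B.history π t ω s).2.1 = x} := by
  classical
  simp only [pairCount, Finset.card_filter, history_apply]
  rw [Finset.sum_range]
  refine Finset.sum_le_sum fun s _ => ?_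
  split_ifs <;> simp_all

include hπ

lemma sum_pairCount (m : Fin M) (t : ℕ) (ω : Sample M) :
    ∑ x ∈ B.actions m, pairCount B π m x t ω = contextCount m t ω := by
  classical
  simp only [contextCount, pairCount]
  rw [Finset.card_eq_sum_card_fiberwise (f := fun s => B.action π s ω) (t := B.actions m)]
  · refine Finset.sum_congr rfl fun x _ => ?_
    rw [Finset.filter_filter]
  · intro s hs
    simp only [Finset.coe_filter, Set.mem_ofPred_eq] at hs
    have := action_mem hπ s ω
    rwa [hs.2] at this

-- Each round has a single context, so it is counted for at most one `m`, even if some of the `v m`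
-- coincide.
omit hπ in
lemma sum_pairCount_mul_le_energy (v : Fin M → Vec d) (t : ℕ) (ω : Sample M) (y : Vec d) :
    ∑ m, (pairCount B π m (v m) t ω : ℝ) * inner ℝ (v m) y ^ 2
      ≤ energy (B.history π t ω) y := by
  classical
  rw [energy_history]
  simp only [pairCount, Finset.card_filter]
  push_cast
  simp only [Finset.sum_mul]
  rw [Finset.sum_comm]
  refine Finset.sum_le_sum fun s _ => ?_
  rw [Finset.sum_eq_single (ω s).1]
  · split_ifs with h
    · rw [h.2, one_mul]
    · rw [zero_mul]; exact sq_nonneg _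
  · intro m _ hm
    rw [if_neg (fun h => hm h.1.symm), zero_mul]
  · simp

/-- If the confidence bounds hold from round `r` on, then a suboptimal action is played in
at most `r + 1` of the rounds, provided that the radii are at most of the order of `r`. -/
lemma pairCount_suboptimal_le {Δ r : ℝ} (hΔ : 0 < Δ)
    (hβ : ∀ t, 0 ≤ β (t + 1)) (hdr : (d : ℝ) ≤ r) {t : ℕ} (ω : Sample M)
    (hr : ∀ s < t, 4 * β (s + 1) ≤ Δ ^ 2 * r)
    (hgood : ∀ s : ℕ, r ≤ s → s < t →
      energy (B.history π s ω) (thetaHat (B.history π s ω) - B.θ) ≤ β (s + 1))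
    {m : Fin M} {x : Vec d} (hgap : Δ ≤ B.optValue m - inner ℝ x B.θ) :
    (pairCount B π m x t ω : ℝ) ≤ r + 1 := by
  classical
  have hr0 : 0 ≤ r := (Nat.cast_nonneg d).trans hdr
  suffices ∀ s ≤ t, (pairCount B π m x s ω : ℝ) ≤ r + 1 from this t le_rfl
  intro s
  induction s with
  | zero => intro _; simp [pairCount]; positivity
  | succ s ih =>
    intro hs
    by_cases hsr : (s : ℝ) < r
    · have := pairCount_le (B := B) (π := π) m x (s + 1) ω
      have : (pairCount B π m x (s + 1) ω : ℝ) ≤ s + 1 := by exact_mod_cast this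
      linarith
    rw [pairCount_succ]
    split_ifs with hp
    · push_cast
      rw [not_lt] at hsr
      have hds : d ≤ s := by exact_mod_cast hdr.trans hsr
      have hG := isUnit_gram_history hπ ω hds
      have h1 := gap_sq_le hπ hds ω hΔ (hβ s) (hgood s hsr hs) (by rw [hp.1, hp.2]; exact hgap)
      have h2 := card_mul_wnorm_sq_le _ hG x
      rw [hp.2] at h1
      have h3 : (pairCount B π m x s ω : ℝ)
          ≤ (Finset.card {i | (B.history π s ω i).2.1 = x} : ℝ) := by
        exact_mod_cast pairCount_le_card_history m x s ω
      set w := wnorm (gram (B.history π s ω))⁻¹ x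
      have h4 : (pairCount B π m x s ω : ℝ) * w ^ 2 ≤ 1 :=
        (mul_le_mul_of_nonneg_right h3 (sq_nonneg _)).trans h2
      -- If the pair is played now, its earlier count `N` satisfies `N Δ² ≤ 4 β N w² ≤ 4 β ≤ r Δ²`.
      -- So `N ≤ r`, and this play brings it to at most `r + 1`.
      have h5 : (pairCount B π m x s ω : ℝ) * Δ ^ 2 ≤ r * Δ ^ 2 := by
        calc (pairCount B π m x s ω : ℝ) * Δ ^ 2
            ≤ pairCount B π m x s ω * (4 * β (s + 1) * w ^ 2) := by gcongr
          _ = 4 * β (s + 1) * (pairCount B π m x s ω * w ^ 2) := by ring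
          _ ≤ 4 * β (s + 1) * 1 := by
              have := hβ s
              gcongr
          _ ≤ r * Δ ^ 2 := by linarith [hr s hs]
      have := le_of_mul_le_mul_right h5 (by positivity)
      linarith
    · simpa using ih (by omega)

/-! ### Confidence radii and eventual optimality -/

omit hπ

/-- The confidence radii `15 d log t`. -/
def radius (d t : ℕ) : ℝ := 15 * d * Real.log t

lemma radius_nonneg (d t : ℕ) : 0 ≤ radius d t :=
  mul_nonneg (by positivity) (Real.log_natCast_nonneg t)

lemma radius_mono (d : ℕ) {s t : ℕ} (hs : 0 < s) (hst : s ≤ t) : radius d s ≤ radius d t := by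
  unfold radius
  gcongr

lemma eventually_radius_le (d : ℕ) {κ : ℝ} (hκ : 0 < κ) :
    ∀ᶠ t : ℕ in atTop, radius d (t + 1) ≤ κ * t := by
  have h1 : ∀ᶠ t : ℕ in atTop, ‖Real.log ((t + 1 : ℕ) : ℝ)‖
      ≤ κ / (30 * (d + 1)) * ‖id ((t + 1 : ℕ) : ℝ)‖ :=
    (tendsto_natCast_atTop_atTop.comp (tendsto_add_atTop_nat 1)).eventually
      (Real.isLittleO_log_id_atTop.bound (by positivity))
  filter_upwards [h1, eventually_ge_atTop 1] with t ht ht1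
  have ht1' : (1 : ℝ) ≤ t := by exact_mod_cast ht1
  have hl : Real.log ((t + 1 : ℕ) : ℝ) ≤ κ / (30 * (d + 1)) * (2 * t) := by
    refine (le_abs_self _).trans (ht.trans ?_)
    have : ‖id ((t + 1 : ℕ) : ℝ)‖ = t + 1 := by
      rw [id, Real.norm_of_nonneg (Nat.cast_nonneg _)]
      push_cast
      rfl
    rw [this]
    gcongr
    linarith
  calc radius d (t + 1) ≤ 15 * (d + 1) * (κ / (30 * (d + 1)) * (2 * t)) := by
        have h0 := Real.log_natCast_nonneg (t + 1)
        unfold radius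
        gcongr
        linarith
    _ = κ * t := by field_simp; ring

lemma eventually_le_mul_natCast (a : ℝ) {κ : ℝ} (hκ : 0 < κ) :
    ∀ᶠ t : ℕ in atTop, a ≤ κ * t :=
  (tendsto_natCast_atTop_atTop.const_mul_atTop hκ).eventually (eventually_ge_atTop a)

/-- Union bound over the `(2 t³ + 1)^d` grid points at level `a = 7 d log t`: the total is at most
`((2 t³ + 1) t^(-7))^d ≤ t^(-3d)`. -/
lemma measure_radius_lt_energy (hπ : π.IsLinUCB B.actions (radius d)) :
    ∀ᶠ t : ℕ in atTop,
      B.law {ω | radius d (t + 1)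
        < energy (B.history π t ω) (thetaHat (B.history π t ω) - B.θ)}
      ≤ ENNReal.ofReal (1 / (t : ℝ) ^ 3) := by
  -- In dimension `0` the radius and the error both vanish, so the strict event is empty. Elsewhere
  -- `d ≥ 1` is needed to pass from `t^(-3d)` to `t^(-3)`.
  rcases Nat.eq_zero_or_pos d with rfl | hd
  · refine Eventually.of_forall fun t => ?_
    have : {ω | radius 0 (t + 1)
        < energy (B.history π t ω) (thetaHat (B.history π t ω) - B.θ)} = ∅ := by
      ext ω
      have : thetaHat (B.history π t ω) - B.θ = 0 := Subsingleton.elim _ _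
      simp [this, energy, radius]
    rw [this, measure_empty]
    exact zero_le
  obtain ⟨l, hl, hle⟩ := exists_energy_lower_bound B
  filter_upwards [eventually_ge_atTop 3, eventually_ge_atTop d, eventually_le_mul_natCast d hl,
    eventually_radius_le d (one_half_pos (α := ℝ))] with t ht3 htd hlt hrad
  have ht3' : (3 : ℝ) ≤ t := by exact_mod_cast ht3
  have hd1 : (1 : ℝ) ≤ d := by exact_mod_cast hd
  have hlog1 : 1 ≤ Real.log t := by
    rw [Real.le_log_iff_exp_le (by linarith)]
    exact Real.exp_one_lt_d9.le.trans (by linarith)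
  have hlogs : Real.log t ≤ Real.log ((t + 1 : ℕ) : ℝ) := by
    apply Real.log_le_log (by linarith)
    push_cast
    linarith
  -- The radius must exceed `2a + 1`; of the `15 d log t`, fourteen parts are `2a` and the last pays
  -- for the rounding error `1`.
  have h14 : 14 * (d * Real.log t) + 1 ≤ radius d (t + 1) := by
    have h1 : 15 * d * Real.log t ≤ radius d (t + 1) := by
      unfold radius
      gcongr
    have h2 : 1 ≤ d * Real.log t := by nlinarith
    linarith
  have hsub : {ω | radius d (t + 1)
        < energy (B.history π t ω) (thetaHat (B.history π t ω) - B.θ)} ⊆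
      ⋃ j ∈ grid d t, {ω | 7 * d * Real.log t ≤
        inner ℝ (noiseSum B.θ (B.history π t ω)) (gridPoint t j)
          - energy (B.history π t ω) (gridPoint t j) / 2} := by
    intro ω hω
    by_contra hnot
    simp only [Set.mem_iUnion, Set.mem_ofPred_eq, not_exists, not_le] at hnot hω
    have := energy_thetaHat_sub_le B.θ (B.history π t ω)
      (fun s => by rw [history_apply]; exact norm_action_le hπ s ω) hl
      (hle π _ hπ ω t htd) (by omega) (a := 7 * d * Real.log t) (by linarith) hlt
      (by exact_mod_cast htd) (fun j hj => (hnot j hj).le)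
    linarith
  refine (measure_mono hsub).trans ((measure_biUnion_finset_le _ _).trans ?_)
  refine (Finset.sum_le_sum fun j _ => measure_le_inner_noiseSum_sub_energy B π t _ _).trans ?_
  rw [Finset.sum_const, card_grid, nsmul_eq_mul, ← ENNReal.ofReal_natCast,
    ← ENNReal.ofReal_mul (Nat.cast_nonneg _)]
  refine ENNReal.ofReal_le_ofReal ?_
  have hexp : Real.exp (-(7 * d * Real.log t)) = (1 / (t : ℝ) ^ 7) ^ d := by
    have : -(7 * d * Real.log t) = d * Real.log (1 / (t : ℝ) ^ 7) := by
      rw [one_div, Real.log_inv, Real.log_pow]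
      push_cast
      ring
    rw [this, Real.exp_nat_mul, Real.exp_log (by positivity)]
  rw [hexp]
  push_cast
  rw [← mul_pow]
  have hbase : (2 * (t : ℝ) ^ 3 + 1) * (1 / (t : ℝ) ^ 7) ≤ 1 / (t : ℝ) ^ 3 := by
    have h1 : 2 * (t : ℝ) ^ 3 + 1 ≤ (t : ℝ) ^ 4 := by
      have : (1 : ℝ) ≤ (t : ℝ) ^ 3 := one_le_pow₀ (by linarith)
      nlinarith
    calc _ ≤ (t : ℝ) ^ 4 * (1 / (t : ℝ) ^ 7) := by gcongr
      _ = _ := by field_simp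
  calc ((2 * (t : ℝ) ^ 3 + 1) * (1 / (t : ℝ) ^ 7)) ^ d ≤ (1 / (t : ℝ) ^ 3) ^ d := by gcongr
    _ ≤ (1 / (t : ℝ) ^ 3) ^ 1 := by
        refine pow_le_pow_of_le_one (by positivity) ?_ hd
        rw [div_le_one (by positivity)]
        exact one_le_pow₀ (by linarith)
    _ = _ := pow_one _

/-- If the optimal actions span the space, then LinUCB eventually plays an optimal action
whenever its confidence bounds have held for a while and each context was frequent enough. -/
lemma exists_eventually_optimal (hπ : π.IsLinUCB B.actions (radius d))
    (hspan : ∀ xstar : Fin M → Vec d, (∀ m, B.IsOptimal m (xstar m)) →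
      Submodule.span ℝ (Set.range xstar) = ⊤) :
    ∃ ε : ℝ, 0 < ε ∧ ∀ᶠ t : ℕ in atTop, ∀ ω : Sample M,
      (∀ s : ℕ, ε * t ≤ s → s ≤ t →
        energy (B.history π s ω) (thetaHat (B.history π s ω) - B.θ) ≤ radius d (s + 1)) →
      (∀ m, (B.p m).toReal / 4 * t ≤ contextCount m t ω) →
      B.optValue (ω t).1 ≤ inner ℝ (B.action π t ω) B.θ := by
  rcases isEmpty_or_nonempty (Sample M) with hS | ⟨⟨ω₀⟩⟩
  · exact ⟨1, one_pos, Eventually.of_forall fun t ω => hS.elim ω⟩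
  obtain ⟨Δ, hΔ, hgap⟩ := exists_gap_pos B
  obtain ⟨q, hq, hqp⟩ := exists_prob_pos B
  obtain ⟨c, hc, hcv⟩ := exists_norm_sq_le_of_span_finset (ι := Fin M) B.allActions
  -- For `d = 0` empty action sets span the space; they are excluded because the policy must select
  -- a member.
  have hK : 0 < K := by
    rw [← B.card_actions (ω₀ 0).1, Finset.card_pos]
    exact ⟨_, action_mem hπ 0 ω₀⟩
  have hK' : (0 : ℝ) < K := by exact_mod_cast hK
  set ε := q / (2 * K) with hε
  have hε0 : 0 < ε := by positivity
  refine ⟨ε, hε0, ?_⟩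
  -- The first radius condition is `4 β ≤ Δ² r` with `r = ε t`, for the suboptimal counts. The
  -- second makes `4 β` at most half of `c ε t Δ²`, for the final contradiction.
  filter_upwards [eventually_le_mul_natCast d hε0, eventually_le_mul_natCast 2 hε0,
    eventually_radius_le d (κ := Δ ^ 2 * ε / 4) (by positivity),
    eventually_radius_le d (κ := Δ ^ 2 * (c * ε) / 8) (by positivity),
    eventually_ge_atTop d, eventually_ge_atTop 1] with t hdt h2t hrad hrad' htd ht1 ω hgood hcount
  have ht0 : (0 : ℝ) < t := by exact_mod_cast ht1
  have hsub : ∀ m, ∀ x, Δ ≤ B.optValue m - inner ℝ x B.θ →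
      (pairCount B π m x t ω : ℝ) ≤ ε * t + 1 := fun m x hx =>
    pairCount_suboptimal_le hπ hΔ (fun s => radius_nonneg d _) hdt ω
      (fun s hs => by
        have := radius_mono d (Nat.succ_pos s) (Nat.succ_le_succ hs.le)
        linarith) (fun s hs hst => hgood s hs hst.le) hx
  -- Pigeonhole: context `m` occurs at least `q t = K · 2 ε t` times and has `K` actions.
  have hfreq : ∀ m, ∃ x ∈ B.actions m, 2 * (ε * t) ≤ (pairCount B π m x t ω : ℝ) := by
    intro m
    by_contra! hlt
    have hne : (B.actions m).Nonempty := by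
      rw [← Finset.card_pos, B.card_actions m]; exact hK
    have h1 := Finset.sum_lt_sum_of_nonempty hne hlt
    rw [Finset.sum_const, B.card_actions m, nsmul_eq_mul, ← Nat.cast_sum,
      sum_pairCount hπ] at h1
    have h2 : (K : ℝ) * (2 * (ε * t)) = q * t := by rw [hε]; field_simp
    have h3 : q * t ≤ (B.p m).toReal / 4 * t := by
      gcongr
      exact hqp m
    linarith [hcount m]
  choose v hvA hv using hfreq
  have hvopt : ∀ m, B.IsOptimal m (v m) := by
    intro m
    refine isOptimal_of_optValue_le B (hvA m) ?_
    -- A suboptimal `v m` would have count at most `ε t + 1`, which is below `2 ε t` because `ε t ≥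
    -- 2`.
    by_contra! hlt
    have := hsub m (v m) (hgap m _ (hvA m) hlt)
    linarith [hv m]
  have hen : ∀ y, c * (ε * t) * ‖y‖ ^ 2 ≤ energy (B.history π t ω) y := by
    intro y
    refine le_trans ?_ (sum_pairCount_mul_le_energy v t ω y)
    calc c * (ε * t) * ‖y‖ ^ 2 = ε * t * (c * ‖y‖ ^ 2) := by ring
      _ ≤ ε * t * ∑ m, inner ℝ (v m) y ^ 2 := by
          gcongr
          exact hcv v (fun m => mem_allActions (hvA m)) (hspan v hvopt) y
      _ = ∑ m, ε * t * inner ℝ (v m) y ^ 2 := Finset.mul_sum _ _ _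
      _ ≤ _ := by
          refine Finset.sum_le_sum fun m _ => ?_
          gcongr
          linarith [hv m, mul_pos hε0 ht0]
  by_contra! hlt
  have hgt := hgap _ _ (action_mem hπ t ω) hlt
  have hG := isUnit_gram_history hπ ω htd
  -- The confidence bound is used at time `t` itself, which lies in the window `[ε t, t]` because `ε
  -- ≤ 1`.
  have h1 := gap_sq_le hπ htd ω hΔ (radius_nonneg d _)
    (hgood t (by
      have : ε ≤ 1 := by
        have h3 : q ≤ 1 := (hqp (ω₀ 0).1).trans (by
          have : (B.p (ω₀ 0).1).toReal ≤ 1 :=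
            ENNReal.toReal_le_of_le_ofReal zero_le_one (by simpa using B.p.coe_le_one _)
          linarith)
        have h4 : (1 : ℝ) ≤ K := by exact_mod_cast hK
        rw [hε, div_le_one (by positivity)]
        linarith
      nlinarith) le_rfl) hgt
  have h2 := mul_wnorm_sq_le _ hG (l := c * (ε * t)) (by positivity) hen (norm_action_le hπ t ω)
  set w := wnorm (gram (B.history π t ω))⁻¹ (B.action π t ω)
  have h3 : c * (ε * t) * Δ ^ 2 ≤ 4 * radius d (t + 1) := by
    calc c * (ε * t) * Δ ^ 2 ≤ c * (ε * t) * (4 * radius d (t + 1) * w ^ 2) := by gcongr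
      _ = 4 * radius d (t + 1) * (c * (ε * t) * w ^ 2) := by ring
      _ ≤ 4 * radius d (t + 1) * 1 := by
          have := radius_nonneg d (t + 1)
          gcongr
      _ = _ := mul_one _
  have h4 : 0 < c * (ε * t) * Δ ^ 2 := by positivity
  nlinarith

end LinUCB

/-! ### From failure probabilities to bounded regret -/

section Regret

variable {d M K : ℕ}

/-- The regret of the action of round `t + 1`. -/
def gap (B : Bandit d M K) (π : Policy d M) (t : ℕ) (ω : Sample M) : ℝ :=
  B.optValue (ω t).1 - inner ℝ (B.action π t ω) B.θ

lemma measurable_gap (B : Bandit d M K) (π : Policy d M) (t : ℕ) : Measurable (gap B π t) := by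
  have hz : Measurable fun ω : Sample M => (ω t).1 := (measurable_pi_apply t).fst
  exact ((Measurable.of_discrete (f := B.optValue)).comp hz).sub
    ((measurable_action B π t).inner measurable_const)

lemma randomRegret_eq (B : Bandit d M K) (π : Policy d M) (n : ℕ) (ω : Sample M) :
    B.randomRegret π n ω = ∑ t ∈ Finset.range n, (gap B π t ω - (ω t).2.1) := by
  simp only [Bandit.randomRegret, gap, Bandit.reward, ← Finset.sum_sub_distrib]
  exact Finset.sum_congr rfl fun t _ => by ring

lemma measurePreserving_noise (B : Bandit d M K) (t : ℕ) :
    MeasurePreserving (fun ω : Sample M => (ω t).2.1) B.law (gaussianReal 0 1) := by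
  have h1 : MeasurePreserving (fun ω : Sample M => ω t) B.law (roundLaw B) :=
    measurePreserving_eval_infinitePi (fun _ : ℕ => roundLaw B) t
  have h2 : MeasurePreserving (Prod.snd : Fin M × ℝ × unitInterval → _) (roundLaw B) _ :=
    measurePreserving_snd
  exact measurePreserving_fst.comp (h2.comp h1)

lemma integrable_noise (B : Bandit d M K) (t : ℕ) :
    Integrable (fun ω : Sample M => (ω t).2.1) B.law := by
  have h : Integrable (id : ℝ → ℝ) (gaussianReal 0 1) :=
    (memLp_id_gaussianReal 1).integrable le_rfl
  exact (measurePreserving_noise B t).integrable_comp_of_integrable h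

lemma integral_noise (B : Bandit d M K) (t : ℕ) : ∫ ω, (ω t).2.1 ∂B.law = 0 := by
  have h := (measurePreserving_noise B t)
  have h2 := integral_map (μ := B.law) h.measurable.aemeasurable
    (f := (id : ℝ → ℝ)) measurable_id.aestronglyMeasurable
  rw [h.map_eq] at h2
  simp only [id] at h2
  rw [← h2, integral_id_gaussianReal]

variable {B : Bandit d M K} {π : Policy d M}

lemma gap_nonneg {β : ℕ → ℝ} (hπ : π.IsLinUCB B.actions β) (t : ℕ) (ω : Sample M) :
    0 ≤ gap B π t ω :=
  sub_nonneg.2 (inner_le_optValue B (action_mem hπ t ω))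

lemma gap_le {β : ℕ → ℝ} (hπ : π.IsLinUCB B.actions β) (t : ℕ) (ω : Sample M) :
    gap B π t ω ≤ 2 * ‖B.θ‖ := by
  have key : ∀ x ∈ B.actions (ω t).1, |inner ℝ x B.θ| ≤ ‖B.θ‖ := fun x hx =>
    (abs_real_inner_le_norm _ _).trans
      (mul_le_of_le_one_left (norm_nonneg _) (B.norm_le_one _ x hx))
  obtain ⟨x, hx, hopt⟩ := exists_eq_optValue B ⟨_, action_mem hπ t ω⟩
  have h1 := (abs_le.1 (key x hx)).2
  have h2 := (abs_le.1 (key _ (action_mem hπ t ω))).1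
  rw [gap, ← hopt]
  linarith

lemma integrable_gap {β : ℕ → ℝ} (hπ : π.IsLinUCB B.actions β) (t : ℕ) :
    Integrable (gap B π t) B.law :=
  Integrable.of_bound (measurable_gap B π t).aestronglyMeasurable (2 * ‖B.θ‖)
    (ae_of_all _ fun ω => by
      rw [Real.norm_of_nonneg (gap_nonneg hπ t ω)]
      exact gap_le hπ t ω)

lemma integrable_randomRegret {β : ℕ → ℝ} (hπ : π.IsLinUCB B.actions β) (n : ℕ) :
    Integrable (B.randomRegret π n) B.law := by
  rw [funext (randomRegret_eq B π n)]
  exact integrable_finsetSum _ fun t _ => (integrable_gap hπ t).sub (integrable_noise B t)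

lemma regret_eq_sum {β : ℕ → ℝ} (hπ : π.IsLinUCB B.actions β) (n : ℕ) :
    B.regret π n = ∑ t ∈ Finset.range n, ∫ ω, gap B π t ω ∂B.law := by
  simp only [Bandit.regret, randomRegret_eq]
  rw [integral_finsetSum (f := fun t ω => gap B π t ω - (ω t).2.1) _
    fun t _ => (integrable_gap hπ t).sub (integrable_noise B t)]
  refine Finset.sum_congr rfl fun t _ => ?_
  rw [integral_sub (integrable_gap hπ t) (integrable_noise B t), integral_noise, sub_zero]

lemma integral_gap_le {β : ℕ → ℝ} (hπ : π.IsLinUCB B.actions β) (t : ℕ) :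
    ∫ ω, gap B π t ω ∂B.law ≤ 2 * ‖B.θ‖ * B.law.real {ω | 0 < gap B π t ω} := by
  have hm : MeasurableSet {ω | 0 < gap B π t ω} :=
    measurableSet_lt measurable_const (measurable_gap B π t)
  calc ∫ ω, gap B π t ω ∂B.law
      ≤ ∫ ω, Set.indicator {ω | 0 < gap B π t ω} (fun _ => 2 * ‖B.θ‖) ω ∂B.law := by
        refine integral_mono (integrable_gap hπ t) ((integrable_const _).indicator hm) fun ω => ?_
        by_cases h : 0 < gap B π t ω
        · rw [Set.indicator_of_mem (by exact h)]
          exact gap_le hπ t ω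
        · rw [Set.indicator_of_notMem (by exact h)]
          exact not_lt.1 h
    _ = 2 * ‖B.θ‖ * B.law.real {ω | 0 < gap B π t ω} := by
        rw [integral_indicator_const _ hm, smul_eq_mul, mul_comm]

/-- A positive gap in round `t + 1` requires a failed confidence bound at some time in `[ε t, t]` or
a context that was too rare. -/
lemma exists_summable_prob_gap_pos (hπ : π.IsLinUCB B.actions (radius d))
    (hspan : ∀ xstar : Fin M → Vec d, (∀ m, B.IsOptimal m (xstar m)) →
      Submodule.span ℝ (Set.range xstar) = ⊤) :
    ∃ ρ : ℕ → ℝ, Summable ρ ∧ ∀ᶠ t in atTop, B.law.real {ω | 0 < gap B π t ω} ≤ ρ t := by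
  obtain ⟨ε, hε, hopt⟩ := exists_eventually_optimal hπ hspan
  obtain ⟨s₀, hs₀⟩ := eventually_atTop.1 (measure_radius_lt_energy hπ)
  refine ⟨fun t => 2 / ε ^ 3 * (1 / (t : ℝ) ^ 2) + ∑ m, Real.exp (-((B.p m).toReal / 4 * t)),
    ?_, ?_⟩
  · refine Summable.add ((Real.summable_one_div_nat_pow.2 one_lt_two).mul_left _)
      (summable_sum fun m _ => ?_)
    have hp : 0 < (B.p m).toReal :=
      ENNReal.toReal_pos (B.p_pos m).ne' (PMF.apply_ne_top _ _)
    have := Real.summable_exp_nat_mul_iff.2 (show -((B.p m).toReal / 4) < 0 by linarith)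
    refine this.congr fun t => ?_
    congr 1
    ring
  · filter_upwards [hopt, eventually_le_mul_natCast s₀ hε, eventually_ge_atTop 1]
      with t ht hst ht1
    have ht1' : (1 : ℝ) ≤ t := by exact_mod_cast ht1
    set F : ℕ → Set (Sample M) := fun s => {ω | radius d (s + 1)
        < energy (B.history π s ω) (thetaHat (B.history π s ω) - B.θ)} with hF
    classical
    set I : Finset ℕ := {s ∈ Finset.range (t + 1) | ε * t ≤ (s : ℝ)} with hI
    have hsub : {ω | 0 < gap B π t ω} ⊆ (⋃ s ∈ I, F s) ∪
        ⋃ m ∈ (Finset.univ : Finset (Fin M)),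
          {ω | (contextCount m t ω : ℝ) ≤ (B.p m).toReal / 4 * t} := by
      intro ω hω
      by_contra hnot
      simp only [Set.mem_union, Set.mem_iUnion, not_or, not_exists, hF, hI, Finset.mem_filter,
        Finset.mem_range, Set.mem_ofPred_eq, not_lt, not_le, Finset.mem_univ, forall_true_left,
        and_imp] at hnot
      have := ht ω (fun s h1 h2 => hnot.1 s (Nat.lt_succ_of_le h2) h1)
        (fun m => (hnot.2 m).le)
      have h2 : 0 < gap B π t ω := hω
      rw [gap] at h2
      linarith
    have hbound : B.law {ω | 0 < gap B π t ω} ≤ ENNReal.ofReal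
        (2 / ε ^ 3 * (1 / (t : ℝ) ^ 2) + ∑ m, Real.exp (-((B.p m).toReal / 4 * t))) := by
      refine (measure_mono hsub).trans ((measure_union_le _ _).trans ?_)
      rw [ENNReal.ofReal_add (by positivity) (Finset.sum_nonneg fun _ _ => (Real.exp_pos _).le),
        ENNReal.ofReal_sum_of_nonneg fun _ _ => (Real.exp_pos _).le]
      refine add_le_add ?_ ((measure_biUnion_finset_le _ _).trans
        (Finset.sum_le_sum fun m _ => measure_contextCount_le B m t))
      refine (measure_biUnion_finset_le _ _).trans ?_
      -- At most `t + 1 ≤ 2 t` times, each failing with probability at most `(ε t)^(-3)`: the cubic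
      -- decay leaves a summable `t^(-2)`.
      calc ∑ s ∈ I, B.law (F s) ≤ ∑ s ∈ I, ENNReal.ofReal (1 / (ε * t) ^ 3) := by
            refine Finset.sum_le_sum fun s hs => ?_
            simp only [hI, Finset.mem_filter] at hs
            have : s₀ ≤ s := by exact_mod_cast hst.trans hs.2
            refine (hs₀ s this).trans (ENNReal.ofReal_le_ofReal ?_)
            gcongr
            exact hs.2
        _ = ENNReal.ofReal (I.card * (1 / (ε * t) ^ 3)) := by
            rw [Finset.sum_const, nsmul_eq_mul, ENNReal.ofReal_mul (Nat.cast_nonneg _),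
              ENNReal.ofReal_natCast]
        _ ≤ ENNReal.ofReal (2 / ε ^ 3 * (1 / (t : ℝ) ^ 2)) := by
            refine ENNReal.ofReal_le_ofReal ?_
            have hcard : (I.card : ℝ) ≤ 2 * t := by
              have h1 : I.card ≤ t + 1 := (Finset.card_filter_le _ _).trans (by simp)
              have h2 : (I.card : ℝ) ≤ t + 1 := by exact_mod_cast h1
              linarith
            calc (I.card : ℝ) * (1 / (ε * t) ^ 3) ≤ 2 * t * (1 / (ε * t) ^ 3) := by gcongr
              _ = 2 / ε ^ 3 * (1 / (t : ℝ) ^ 2) := by field_simp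
    exact ENNReal.toReal_le_of_le_ofReal (add_nonneg (by positivity)
      (Finset.sum_nonneg fun _ _ => (Real.exp_pos _).le)) hbound

lemma exists_regret_le (hπ : π.IsLinUCB B.actions (radius d))
    (hspan : ∀ xstar : Fin M → Vec d, (∀ m, B.IsOptimal m (xstar m)) →
      Submodule.span ℝ (Set.range xstar) = ⊤) :
    ∃ D : ℝ, ∀ n, B.regret π n ≤ D := by
  obtain ⟨ρ, hρ, hle⟩ := exists_summable_prob_gap_pos hπ hspan
  have hnn : ∀ t, 0 ≤ ∫ ω, gap B π t ω ∂B.law := fun t => integral_nonneg (gap_nonneg hπ t)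
  have hsum : Summable fun t => ∫ ω, gap B π t ω ∂B.law := by
    refine Summable.of_norm_bounded_eventually_nat (hρ.mul_left (2 * ‖B.θ‖)) ?_
    filter_upwards [hle] with t ht
    rw [Real.norm_of_nonneg (hnn t)]
    exact (integral_gap_le hπ t).trans (by gcongr)
  refine ⟨∑' t, ∫ ω, gap B π t ω ∂B.law, fun n => ?_⟩
  rw [regret_eq_sum hπ]
  exact hsum.sum_le_tsum _ fun t _ => hnn t

end Regret

end LinBandit

end

theorem theorem3 :
    ∃ C : ℝ, 0 < C ∧ ∀ d : ℕ, ∃ β : ℕ → ℝ,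
      (∀ t : ℕ, 0 ≤ β t) ∧
      (∀ t : ℕ, 2 ≤ t → β t ≤ C * (d : ℝ) * Real.log (t : ℝ)) ∧
      ∀ (M K : ℕ) (B : LinBandit.Bandit d M K),
        (∀ xstar : Fin M → LinBandit.Vec d, (∀ m, B.IsOptimal m (xstar m)) →
          Submodule.span ℝ (Set.range xstar) = ⊤) →
        ∀ π : LinBandit.Policy d M, π.IsLinUCB B.actions β →
          (∀ n : ℕ, Integrable (B.randomRegret π n) B.law) ∧
          limsup (fun n : ℕ => ((B.regret π n : ℝ) : EReal)) atTop < ⊤ := by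
  refine ⟨15, by norm_num, fun d => ⟨LinBandit.radius d, LinBandit.radius_nonneg d,
    fun _ _ => le_rfl, fun M K B hspan π hπ => ⟨LinBandit.integrable_randomRegret hπ, ?_⟩⟩⟩
  obtain ⟨D, hD⟩ := LinBandit.exists_regret_le hπ hspan
  exact lt_of_le_of_lt (limsup_le_of_le (h := Eventually.of_forall fun n =>
    EReal.coe_le_coe_iff.2 (hD n))) (EReal.coe_lt_top D)
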